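/- Let $(M_n,Q_n)_{n\ge 1}$ be i.i.d. $\mathbb{R}^2$-valued random vectors with generic copy $(M,Q)$, put $\Pi_0=1$, $\Pi_n=M_1M_2\cdots M_n$, and let $$Z_\infty=\lim_{n\to\infty}\sum_{k=1}^{n}\Pi_{k-1}Q_k$$ be the associated perpetuity, with the convention $|Z_\infty|=\infty$ and $e^{r|Z_\infty|}=\infty$ ($r>0$) where this limit does not exist in $\mathbb{R}$; thus $\mathbb{E}e^{s|Z_\infty|}<\infty$ includes the almost sure convergence of the series. For a random variable $Z$ let $$r(Z)=\sup\{r>0:\ \mathbb{E}e^{r|Z|}<\infty\}\in[0,\infty],\qquad \sup\emptyset=0,$$ be the abscissa of convergence of the moment generating function of $|Z|$. Suppose that $\mathbb{P}\{M=0\}=0$, $\mathbb{P}\{Q=0\}<1$, $\mathbb{P}\{Q+Mc=c\}<1$ for all $c\in\mathbb{R}$, and $\mathbb{P}\{|M|=1\}=0$. Then, for every $s>0$, $$\mathbb{E}e^{s|Z_\infty|}<\infty\quad\Longleftrightarrow\quad \mathbb{P}\{|M|<1\}=1\ \text{ and }\ \mathbb{E}e^{s|Q|}<\infty .$$ In particular,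 if $\mathbb{P}\{|M|<1\}=1$, then $r(Z_\infty)=r(Q)$. -/

import Mathlib

open MeasureTheory ProbabilityTheory Filter Topology
open scoped ENNReal

namespace Perpetuity

/-- The partial product `M 0 * ... * M (n - 1)` of the first `n` terms of a sequence whose first
term has index `0` (and `1` for `n = 0`). -/
noncomputable def partialProd {Ω : Type*} (M : ℕ → Ω → ℝ) (n : ℕ) (ω : Ω) : ℝ :=
  ∏ k ∈ Finset.range n, M k ω

/-- The partial sum of the first `n` terms of the series of discounted payments: the `k`-th `Q` is
multiplied by the product of all `M`'s of strictly smaller index. -/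
noncomputable def partialSum {Ω : Type*} (M Q : ℕ → Ω → ℝ) (n : ℕ) (ω : Ω) : ℝ :=
  ∑ k ∈ Finset.range n, partialProd M k ω * Q k ω

open Classical in
/-- The perpetuity: the sum of the series, i.e. the limit of the partial sums, at each `ω` where
they converge in `ℝ`, and `⊤` (infinite) at each `ω` where they do not. -/
noncomputable def perpetuity {Ω : Type*} (M Q : ℕ → Ω → ℝ) (ω : Ω) : EReal :=
  if h : ∃ z : ℝ, Tendsto (fun n => partialSum M Q n ω) atTop (𝓝 z) then (h.choose : EReal) else ⊤

/-- The exponential moment `E exp (s |Z|)` in `[0, ∞]` of an extended real random variable; the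
integrand is `∞` where `|Z| = ∞` (for `s > 0`). -/
noncomputable def expMoment {Ω : Type*} [MeasurableSpace Ω] (μ : Measure Ω) (s : ℝ)
    (Z : Ω → EReal) : ℝ≥0∞ :=
  ∫⁻ ω, EReal.exp ((s : EReal) * (((Z ω).abs : ℝ≥0∞) : EReal)) ∂μ

/-- The abscissa of convergence `sup {r > 0 : E exp (r |Z|) < ∞}` in `[0, ∞]` of the moment
generating function of `|Z|`; it is `0` if no `r > 0` qualifies. -/
noncomputable def abscissa {Ω : Type*} [MeasurableSpace Ω] (μ : Measure Ω)
    (Z : Ω → EReal) : ℝ≥0∞ :=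
  sSup {a : ℝ≥0∞ | ∃ r : ℝ, 0 < r ∧ expMoment μ r Z < ∞ ∧ a = ENNReal.ofReal r}

end Perpetuity

namespace Perpetuity

/-! Splitting off the first pair of the sequence gives Z = Q + M Z', with Z' a copy of Z independent
of (M, Q).

Sufficiency. Let φ_n(t) be the exponential moment at t of the n-th partial sum of absolute values.
Conditioning on the first pair gives φ_{n+1}(t) = E[e^{t|Q|} φ_n(t|M|)] (`absMoment_succ`). For
small t, convexity of exp turns this into a contracting affine recursion
(`absMoment_bounded_of_lt_one`). Splitting at |M| = b with b near 1 passes boundedness in n from tb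
to t (`absMoment_bounded_of_mul`). Finitely many such steps reach s, and monotone convergence
concludes.

Necessity. The law η of Z is stationary under z ↦ Q + Mz. Driving both coordinates of a
self-coupling of η by the same (M, Q) gives another self-coupling and multiplies E|z₁ - z₂|^p by
E|M|^p. The supremum of this moment over self-couplings is finite by the exponential moment and
positive by nondegeneracy, so E|M|^p ≤ 1 for all p ≥ 1 (`lintegral_pow_le_one`), whence |M| ≤ 1 a.s.
Once |M| < 1, the bound |Q| ≤ |Z| + |Z'| and the independence of Q and Z' control E e^{s|Q|}. -/

/-- The exponential function with values in `[0, ∞]`. -/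
noncomputable def eexp (t : ℝ) : ℝ≥0∞ := ENNReal.ofReal (Real.exp t)

lemma measurable_eexp : Measurable eexp := by
  unfold eexp; fun_prop

@[fun_prop]
lemma Measurable.eexp {α : Type*} [MeasurableSpace α] {f : α → ℝ} (hf : Measurable f) :
    Measurable fun x => eexp (f x) := measurable_eexp.comp hf

lemma continuous_eexp : Continuous eexp := by
  unfold eexp; exact ENNReal.continuous_ofReal.comp Real.continuous_exp

lemma eexp_zero : eexp 0 = 1 := by simp [eexp]

lemma eexp_add (a b : ℝ) : eexp (a + b) = eexp a * eexp b := by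
  simp [eexp, Real.exp_add, ENNReal.ofReal_mul (Real.exp_pos a).le]

lemma eexp_mono {a b : ℝ} (h : a ≤ b) : eexp a ≤ eexp b :=
  ENNReal.ofReal_le_ofReal (Real.exp_le_exp.2 h)

lemma eexp_pos (a : ℝ) : 0 < eexp a := ENNReal.ofReal_pos.2 (Real.exp_pos a)

lemma ofReal_le_eexp (a : ℝ) : ENNReal.ofReal a ≤ eexp a :=
  ENNReal.ofReal_le_ofReal (by linarith [Real.add_one_le_exp a])

lemma exp_mul_abs_coe (s z : ℝ) :
    EReal.exp ((s : EReal) * (((z : EReal).abs : ℝ≥0∞) : EReal)) = eexp (s * |z|) := by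
  rw [EReal.coe_abs, ← EReal.coe_mul, EReal.exp_coe, eexp]

/-! ### Splitting off the first term of an i.i.d. sequence. -/

/-- The sequence with first term `p.1` followed by the terms of `p.2`. -/
def consSeq {α : Type*} (p : α × (ℕ → α)) (n : ℕ) : α := n.casesOn p.1 p.2

lemma consSeq_zero {α : Type*} (p : α × (ℕ → α)) : consSeq p 0 = p.1 := rfl

lemma consSeq_succ {α : Type*} (p : α × (ℕ → α)) (n : ℕ) : consSeq p (n + 1) = p.2 n := rfl

lemma measurable_consSeq {α : Type*} [MeasurableSpace α] :
    Measurable (consSeq : α × (ℕ → α) → ℕ → α) := by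
  refine measurable_pi_iff.2 fun n => ?_
  cases n with
  | zero => exact measurable_fst
  | succ n => exact (measurable_pi_apply n).comp measurable_snd

/-- An i.i.d. sequence is an independent first term followed by an i.i.d. sequence. -/
lemma map_consSeq {α : Type*} [MeasurableSpace α] (ν : Measure α) [IsProbabilityMeasure ν] :
    (ν.prod (Measure.infinitePi fun _ : ℕ => ν)).map consSeq =
      Measure.infinitePi fun _ : ℕ => ν := by
  classical
  refine Measure.eq_infinitePi (fun _ : ℕ => ν) fun s t ht => ?_
  obtain ⟨n, hn⟩ : ∃ n, s ⊆ Finset.range (n + 1) :=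
    ⟨s.sup id, fun i hi => Finset.mem_range.2 (Nat.lt_succ_of_le (Finset.le_sup (f := id) hi))⟩
  -- Padding with `Set.univ` makes the cylinder live on an initial segment, where coordinate 0
  -- separates from the shifted rest.
  set t' : ℕ → Set α := fun i => if i ∈ s then t i else Set.univ with ht'
  have mt' : ∀ i, MeasurableSet (t' i) := fun i => by
    simp only [ht']; split_ifs; exacts [ht i, .univ]
  have hpre : consSeq ⁻¹' (Set.pi s t) =
      t' 0 ×ˢ Set.pi (Finset.range n : Finset ℕ) (fun i => t' (i + 1)) := by
    ext p
    simp only [Set.mem_preimage, Set.mem_pi, Finset.mem_coe, Set.mem_prod, Finset.mem_range, ht']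
    constructor
    · intro h
      refine ⟨?_, fun i _ => ?_⟩
      · split_ifs with h0
        exacts [h 0 h0, trivial]
      · split_ifs with h0
        exacts [h (i + 1) h0, trivial]
    · rintro ⟨h0, h1⟩ i hi
      cases i with
      | zero => simpa [hi, consSeq_zero] using h0
      | succ i =>
        have := h1 i (by have := Finset.mem_range.1 (hn hi); omega)
        simpa [hi, consSeq_succ] using this
  have hprod : ∏ i ∈ s, ν (t i) = ∏ i ∈ Finset.range (n + 1), ν (t' i) := by
    rw [← Finset.prod_subset hn]
    · exact Finset.prod_congr rfl fun i hi => by simp [ht', hi]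
    · intro i _ hi
      simp [ht', hi]
  rw [Measure.map_apply measurable_consSeq (.pi s.countable_toSet fun i _ => ht i), hpre,
    Measure.prod_prod, Measure.infinitePi_pi _ fun i _ => mt' _, hprod, Finset.prod_range_succ',
    mul_comm]

lemma lintegral_infinitePi_consSeq {α : Type*} [MeasurableSpace α] (ν : Measure α)
    [IsProbabilityMeasure ν] {f : (ℕ → α) → ℝ≥0∞} (hf : Measurable f) :
    ∫⁻ x, f x ∂(Measure.infinitePi fun _ : ℕ => ν) =
      ∫⁻ a, ∫⁻ x, f (consSeq (a, x)) ∂(Measure.infinitePi fun _ : ℕ => ν) ∂ν := by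
  conv_lhs => rw [← map_consSeq ν]
  rw [lintegral_map hf measurable_consSeq]
  exact lintegral_prod _ (hf.comp measurable_consSeq).aemeasurable

/-! ### Measurability of the perpetuity. -/

section PathSums

variable {Ω : Type*} {M Q : ℕ → Ω → ℝ}

lemma measurable_partialSum [MeasurableSpace Ω] (hM : ∀ n, Measurable (M n))
    (hQ : ∀ n, Measurable (Q n)) (n : ℕ) : Measurable (partialSum M Q n) := by
  unfold partialSum partialProd
  fun_prop

lemma perpetuity_eq_of_tendsto {ω : Ω} {z : ℝ}
    (h : Tendsto (fun n => partialSum M Q n ω) atTop (𝓝 z)) : perpetuity M Q ω = z := by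
  have hex : ∃ z : ℝ, Tendsto (fun n => partialSum M Q n ω) atTop (𝓝 z) := ⟨z, h⟩
  rw [perpetuity, dif_pos hex, tendsto_nhds_unique hex.choose_spec h]

lemma perpetuity_eq_top {ω : Ω}
    (h : ¬ ∃ z : ℝ, Tendsto (fun n => partialSum M Q n ω) atTop (𝓝 z)) :
    perpetuity M Q ω = ⊤ := dif_neg h

/-- The limit of the partial sums as a real number (with a default value where it fails to
exist). -/
noncomputable def limitSum (M Q : ℕ → Ω → ℝ) (ω : Ω) : ℝ :=
  limUnder atTop fun n => partialSum M Q n ω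

lemma measurable_limitSum [MeasurableSpace Ω] (hM : ∀ n, Measurable (M n))
    (hQ : ∀ n, Measurable (Q n)) : Measurable (limitSum M Q) :=
  (StronglyMeasurable.limUnder fun n => (measurable_partialSum hM hQ n).stronglyMeasurable).measurable

lemma measurableSet_summable [MeasurableSpace Ω] (hM : ∀ n, Measurable (M n))
    (hQ : ∀ n, Measurable (Q n)) :
    MeasurableSet {ω | ∃ z : ℝ, Tendsto (fun n => partialSum M Q n ω) atTop (𝓝 z)} :=
  measurableSet_exists_tendsto fun n => measurable_partialSum hM hQ n

open Classical in
lemma perpetuity_eq_ite : perpetuity M Q = fun ω =>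
    if ω ∈ {ω | ∃ z : ℝ, Tendsto (fun n => partialSum M Q n ω) atTop (𝓝 z)} then
      (limitSum M Q ω : EReal) else ⊤ := by
  ext ω
  split_ifs with h
  · exact perpetuity_eq_of_tendsto (tendsto_nhds_limUnder h)
  · exact perpetuity_eq_top h

lemma measurable_perpetuity [MeasurableSpace Ω] (hM : ∀ n, Measurable (M n))
    (hQ : ∀ n, Measurable (Q n)) : Measurable (perpetuity M Q) := by
  classical
  rw [perpetuity_eq_ite]
  exact Measurable.ite (measurableSet_summable hM hQ)
    (measurable_coe_real_ereal.comp (measurable_limitSum hM hQ)) measurable_const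

end PathSums

/-! ### The coordinate model on sequences of pairs. -/

/-- The first components of a sequence of pairs. -/
def fstSeq (n : ℕ) (x : ℕ → ℝ × ℝ) : ℝ := (x n).1

/-- The second components of a sequence of pairs. -/
def sndSeq (n : ℕ) (x : ℕ → ℝ × ℝ) : ℝ := (x n).2

lemma measurable_fstSeq (n : ℕ) : Measurable (fstSeq n) := (measurable_pi_apply n).fst

lemma measurable_sndSeq (n : ℕ) : Measurable (sndSeq n) := (measurable_pi_apply n).snd

lemma partialSum_consSeq (a : ℝ × ℝ) (x : ℕ → ℝ × ℝ) (n : ℕ) :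
    partialSum fstSeq sndSeq (n + 1) (consSeq (a, x)) =
      a.2 + a.1 * partialSum fstSeq sndSeq n x := by
  simp only [partialSum, partialProd, Finset.sum_range_succ' _ n, Finset.prod_range_succ',
    fstSeq, sndSeq, consSeq_zero, consSeq_succ, Finset.mul_sum]
  simp only [Finset.range_zero, Finset.prod_empty, one_mul]
  rw [add_comm]
  congr 1
  exact Finset.sum_congr rfl fun i _ => by ring

/-- The partial sums of the series of absolute values. -/
noncomputable def absPartialSum (n : ℕ) (x : ℕ → ℝ × ℝ) : ℝ :=
  ∑ k ∈ Finset.range n, |partialProd fstSeq k x * sndSeq k x|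

lemma measurable_absPartialSum (n : ℕ) : Measurable (absPartialSum n) := by
  unfold absPartialSum partialProd fstSeq sndSeq
  fun_prop

lemma absPartialSum_nonneg (n : ℕ) (x : ℕ → ℝ × ℝ) : 0 ≤ absPartialSum n x :=
  Finset.sum_nonneg fun _ _ => abs_nonneg _

lemma absPartialSum_consSeq (a : ℝ × ℝ) (x : ℕ → ℝ × ℝ) (n : ℕ) :
    absPartialSum (n + 1) (consSeq (a, x)) = |a.2| + |a.1| * absPartialSum n x := by
  simp only [absPartialSum, partialProd, Finset.sum_range_succ' _ n, Finset.prod_range_succ',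
    fstSeq, sndSeq, consSeq_zero, consSeq_succ, Finset.mul_sum]
  simp only [Finset.range_zero, Finset.prod_empty, one_mul]
  rw [add_comm]
  congr 1
  refine Finset.sum_congr rfl fun i _ => ?_
  rw [← abs_mul]
  congr 1
  ring

lemma abs_partialSum_le (n : ℕ) (x : ℕ → ℝ × ℝ) :
    |partialSum fstSeq sndSeq n x| ≤ absPartialSum n x :=
  Finset.abs_sum_le_sum_abs _ _

lemma absPartialSum_mono (x : ℕ → ℝ × ℝ) : Monotone fun n => absPartialSum n x :=
  monotone_nat_of_le_succ fun n => by
    simp only [absPartialSum, Finset.sum_range_succ]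
    linarith [abs_nonneg (partialProd fstSeq n x * sndSeq n x)]

/-! ### Sufficiency: bounded exponential moments of the absolute partial sums. -/

section Sufficiency

variable (ν : Measure (ℝ × ℝ))

/-- The exponential moments of the partial sums of absolute values. -/
noncomputable def absMoment (t : ℝ) (n : ℕ) : ℝ≥0∞ :=
  ∫⁻ x, eexp (t * absPartialSum n x) ∂(Measure.infinitePi fun _ : ℕ => ν)

lemma absMoment_mono {t t' : ℝ} (h : t ≤ t') (n : ℕ) : absMoment ν t n ≤ absMoment ν t' n :=
  lintegral_mono fun x => eexp_mono (mul_le_mul_of_nonneg_right h (absPartialSum_nonneg n x))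

lemma measurable_eexp_absPartialSum (t : ℝ) (n : ℕ) :
    Measurable fun x => eexp (t * absPartialSum n x) :=
  measurable_eexp.comp ((measurable_absPartialSum n).const_mul t)

lemma absMoment_zero [IsProbabilityMeasure ν] (t : ℝ) : absMoment ν t 0 = 1 := by
  simp [absMoment, absPartialSum, eexp_zero]

/-- Conditioning on the first pair: the remaining sum has the original law, scaled by |M|, and the
scale moves into the argument. -/
lemma absMoment_succ [IsProbabilityMeasure ν] (t : ℝ) (n : ℕ) :
    absMoment ν t (n + 1) = ∫⁻ a, eexp (t * |a.2|) * absMoment ν (t * |a.1|) n ∂ν := by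
  rw [absMoment, lintegral_infinitePi_consSeq ν (measurable_eexp_absPartialSum t (n + 1))]
  refine lintegral_congr fun a => ?_
  rw [absMoment, ← lintegral_const_mul _ (measurable_eexp_absPartialSum _ n)]
  refine lintegral_congr fun x => ?_
  rw [absPartialSum_consSeq, mul_add, eexp_add, mul_assoc t]

/-- A sequence dominated by a contracting affine recursion is bounded. -/
lemma exists_bound_of_le_affine {u : ℕ → ℝ≥0∞} {C ε : ℝ≥0∞} (h0 : u 0 ≠ ∞) (hC : C ≠ ∞)
    (hε : ε < 1) (h : ∀ n, u (n + 1) ≤ C + ε * u n) : ∃ B, B ≠ ∞ ∧ ∀ n, u n ≤ B := by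
  have hd : 1 - ε ≠ 0 := (tsub_pos_of_lt hε).ne'
  have hd' : 1 - ε ≠ ∞ := ne_top_of_le_ne_top ENNReal.one_ne_top tsub_le_self
  set B : ℝ≥0∞ := (C + u 0) / (1 - ε) with hB
  have hBt : B ≠ ∞ := ENNReal.div_ne_top (ENNReal.add_ne_top.2 ⟨hC, h0⟩) hd
  have hBm : (1 - ε) * B = C + u 0 := ENNReal.mul_div_cancel hd hd'
  have hBs : C + ε * B ≤ B := by
    calc C + ε * B ≤ (1 - ε) * B + ε * B := by rw [hBm]; gcongr; exact le_self_add
      _ = B := by rw [← add_mul, tsub_add_cancel_of_le hε.le, one_mul]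
  refine ⟨B, hBt, fun n => ?_⟩
  induction n with
  | zero =>
    calc u 0 ≤ (1 - ε) * B := by rw [hBm]; exact le_add_self
      _ ≤ 1 * B := by gcongr; exact tsub_le_self
      _ = B := one_mul B
  | succ n ih => exact (h n).trans (le_trans (by gcongr) hBs)

/-- Convexity of exp on the segment from 0 to a. The factor m is what makes the moment recursion
contract. -/
lemma eexp_mul_le_convex {m : ℝ} (h0 : 0 ≤ m) (h1 : m ≤ 1) (a : ℝ) :
    eexp (m * a) ≤ 1 + ENNReal.ofReal m * eexp a := by
  have h := convexOn_exp.2 (Set.mem_univ a) (Set.mem_univ 0) h0 (sub_nonneg.2 h1) (by ring)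
  simp only [smul_eq_mul, mul_zero, add_zero, Real.exp_zero, mul_one] at h
  rw [eexp, eexp, ← ENNReal.ofReal_mul h0, ← ENNReal.ofReal_one,
    ← ENNReal.ofReal_add zero_le_one (by positivity)]
  exact ENNReal.ofReal_le_ofReal (by linarith)

variable {ν}

lemma absMoment_bounded_of_lt_one [IsProbabilityMeasure ν] (hν : ∀ᵐ a ∂ν, |a.1| < 1) {t : ℝ}
    (hK : ∫⁻ a, eexp (t * |a.2|) ∂ν ≠ ∞)
    (ht : ∫⁻ a, eexp (t * |a.2|) * ENNReal.ofReal |a.1| ∂ν < 1) :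
    ∃ B, B ≠ ∞ ∧ ∀ n, absMoment ν t n ≤ B := by
  refine exists_bound_of_le_affine (by simp [absMoment_zero]) hK ht fun n => ?_
  rw [absMoment_succ]
  calc ∫⁻ a, eexp (t * |a.2|) * absMoment ν (t * |a.1|) n ∂ν
      ≤ ∫⁻ a, (eexp (t * |a.2|) +
          eexp (t * |a.2|) * ENNReal.ofReal |a.1| * absMoment ν t n) ∂ν := by
        refine lintegral_mono_ae ?_
        filter_upwards [hν] with a ha
        rw [mul_assoc, ← mul_one_add]
        gcongr
        calc absMoment ν (t * |a.1|) n
            ≤ ∫⁻ x, (1 + ENNReal.ofReal |a.1| * eexp (t * absPartialSum n x))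
                ∂(Measure.infinitePi fun _ : ℕ => ν) := by
              refine lintegral_mono fun x => ?_
              rw [mul_comm t, mul_assoc]
              exact eexp_mul_le_convex (abs_nonneg _) ha.le _
          _ = 1 + ENNReal.ofReal |a.1| * absMoment ν t n := by
              rw [lintegral_add_left measurable_const,
                lintegral_const_mul _ (measurable_eexp_absPartialSum t n)]
              simp [absMoment]
    _ = _ := by
        rw [lintegral_add_left (by fun_prop), lintegral_mul_const _ (by fun_prop)]

/-- By dominated convergence the integral tends to E|M| < 1 as t decreases to 0. -/
lemma exists_small_integral_lt_one [IsProbabilityMeasure ν] (hν : ∀ᵐ a ∂ν, |a.1| < 1) {s : ℝ} (hs : 0 < s)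
    (hK : ∫⁻ a, eexp (s * |a.2|) ∂ν ≠ ∞) :
    ∃ t, 0 < t ∧ ∫⁻ a, eexp (t * |a.2|) * ENNReal.ofReal |a.1| ∂ν < 1 := by
  have hlim : Tendsto (fun k : ℕ => ∫⁻ a, eexp (s / (k + 1) * |a.2|) * ENNReal.ofReal |a.1| ∂ν)
      atTop (𝓝 (∫⁻ a, ENNReal.ofReal |a.1| ∂ν)) := by
    refine tendsto_lintegral_of_dominated_convergence (fun a => eexp (s * |a.2|))
      (fun k => by fun_prop) (fun k => ?_) hK (Eventually.of_forall fun a => ?_)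
    · filter_upwards [hν] with a ha
      calc eexp (s / (k + 1) * |a.2|) * ENNReal.ofReal |a.1| ≤ eexp (s * |a.2|) * 1 := by
            gcongr
            · apply eexp_mono
              gcongr
              exact div_le_self hs.le (by linarith [k.cast_nonneg (α := ℝ)])
            · simpa using ha.le
        _ = _ := mul_one _
    · have h1 : Tendsto (fun k : ℕ => s / ((k : ℝ) + 1)) atTop (𝓝 0) :=
        tendsto_const_nhds.div_atTop
          (tendsto_atTop_add_const_right _ _ tendsto_natCast_atTop_atTop)
      have h2 : Tendsto (fun k : ℕ => eexp (s / ((k : ℝ) + 1) * |a.2|)) atTop (𝓝 1) := by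
        have := (continuous_eexp.tendsto _).comp (h1.mul_const |a.2|)
        simpa [eexp_zero, Function.comp_def] using this
      simpa using ENNReal.Tendsto.mul_const h2 (Or.inr ENNReal.ofReal_ne_top)
  have hlt : ∫⁻ a, ENNReal.ofReal |a.1| ∂ν < 1 := by
    have hle : ∫⁻ a, ENNReal.ofReal |a.1| ∂ν ≤ ∫⁻ _, 1 ∂ν :=
      lintegral_mono_ae (by filter_upwards [hν] with a ha; simpa using ha.le)
    have := lintegral_strict_mono (μ := ν) (f := fun a => ENNReal.ofReal |a.1|) (g := fun _ => 1)
      (IsProbabilityMeasure.ne_zero ν) aemeasurable_const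
      (ne_top_of_le_ne_top (by simp) hle)
      (by filter_upwards [hν] with a ha; simpa using ha)
    simpa using this
  obtain ⟨k, hk⟩ := (hlim.eventually_lt_const hlt).exists
  exact ⟨s / (k + 1), by positivity, hk⟩

/-- As b increases to 1 the events |M| > b shrink to a null set, so the integral tends to 0. -/
lemma exists_tail_integral_lt_one (hν : ∀ᵐ a ∂ν, |a.1| < 1) {s : ℝ}
    (hK : ∫⁻ a, eexp (s * |a.2|) ∂ν ≠ ∞) :
    ∃ b, 0 < b ∧ b < 1 ∧
      ∫⁻ a, {a : ℝ × ℝ | b < |a.1|}.indicator (fun a => eexp (s * |a.2|)) a ∂ν < 1 := by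
  have hms : ∀ b : ℝ, MeasurableSet {a : ℝ × ℝ | b < |a.1|} := fun b =>
    measurableSet_lt measurable_const (by fun_prop)
  -- The shift by 2 keeps b positive even for k = 0.
  have hlim : Tendsto (fun k : ℕ => ∫⁻ a, {a : ℝ × ℝ | 1 - 1 / ((k : ℝ) + 2) < |a.1|}.indicator
      (fun a => eexp (s * |a.2|)) a ∂ν) atTop (𝓝 (∫⁻ _, 0 ∂ν)) := by
    refine tendsto_lintegral_of_dominated_convergence (fun a => eexp (s * |a.2|))
      (fun k => (by fun_prop : Measurable fun a : ℝ × ℝ => eexp (s * |a.2|)).indicator (hms _))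
      (fun k => Eventually.of_forall fun a => Set.indicator_le_self' (fun _ _ => zero_le) a) hK ?_
    filter_upwards [hν] with a ha
    have h1 : Tendsto (fun k : ℕ => 1 - 1 / ((k : ℝ) + 2)) atTop (𝓝 (1 - 0)) :=
      tendsto_const_nhds.sub (tendsto_const_nhds.div_atTop
        (tendsto_atTop_add_const_right _ _ tendsto_natCast_atTop_atTop))
    refine tendsto_const_nhds.congr' ?_
    filter_upwards [h1.eventually_const_lt (by simpa using ha)] with k hk
    rw [Set.indicator_of_notMem]
    simpa using hk.le
  rw [lintegral_zero] at hlim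
  obtain ⟨k, hk⟩ := (hlim.eventually_lt_const zero_lt_one).exists
  have hk2 : (1 : ℝ) / (k + 2) < 1 := by
    rw [div_lt_one (by positivity)]
    linarith [k.cast_nonneg (α := ℝ)]
  exact ⟨_, sub_pos.2 hk2, sub_lt_self _ (by positivity), hk⟩

/-- Where |M| ≤ b, the known bound at tb applies. Where |M| > b, the moment at t itself reappears,
but with a coefficient below 1. -/
lemma absMoment_bounded_of_mul [IsProbabilityMeasure ν] {s t b : ℝ} (ht : 0 ≤ t) (hts : t ≤ s) (hν : ∀ᵐ a ∂ν, |a.1| < 1)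
    (hK : ∫⁻ a, eexp (s * |a.2|) ∂ν ≠ ∞)
    (hb : ∫⁻ a, {a : ℝ × ℝ | b < |a.1|}.indicator (fun a => eexp (s * |a.2|)) a ∂ν < 1)
    (h : ∃ B, B ≠ ∞ ∧ ∀ n, absMoment ν (t * b) n ≤ B) :
    ∃ B, B ≠ ∞ ∧ ∀ n, absMoment ν t n ≤ B := by
  obtain ⟨B, hB, hle⟩ := h
  have hms : MeasurableSet {a : ℝ × ℝ | b < |a.1|} :=
    measurableSet_lt measurable_const (by fun_prop)
  refine exists_bound_of_le_affine (by simp [absMoment_zero]) (ENNReal.mul_ne_top hK hB) hb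
    fun n => ?_
  rw [absMoment_succ]
  calc ∫⁻ a, eexp (t * |a.2|) * absMoment ν (t * |a.1|) n ∂ν
      ≤ ∫⁻ a, (eexp (s * |a.2|) * B +
          {a : ℝ × ℝ | b < |a.1|}.indicator (fun a => eexp (s * |a.2|)) a * absMoment ν t n) ∂ν := by
        refine lintegral_mono_ae ?_
        filter_upwards [hν] with a ha
        have hq : eexp (t * |a.2|) ≤ eexp (s * |a.2|) := eexp_mono (by gcongr)
        by_cases hab : b < |a.1|
        · rw [Set.indicator_of_mem (by exact hab)]
          refine le_trans ?_ le_add_self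
          gcongr
          exact absMoment_mono ν (mul_le_of_le_one_right ht ha.le) n
        · refine le_trans ?_ le_self_add
          gcongr
          exact (absMoment_mono ν (mul_le_mul_of_nonneg_left (not_lt.1 hab) ht) n).trans (hle n)
    _ = _ := by
        rw [lintegral_add_left (by fun_prop), lintegral_mul_const _ (by fun_prop),
          lintegral_mul_const _
            ((by fun_prop : Measurable fun a : ℝ × ℝ => eexp (s * |a.2|)).indicator hms)]

lemma absMoment_bounded [IsProbabilityMeasure ν] (hν : ∀ᵐ a ∂ν, |a.1| < 1) {s : ℝ} (hs : 0 < s)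
    (hK : ∫⁻ a, eexp (s * |a.2|) ∂ν ≠ ∞) :
    ∃ B, B ≠ ∞ ∧ ∀ n, absMoment ν s n ≤ B := by
  obtain ⟨t₀, ht₀, hlt⟩ := exists_small_integral_lt_one hν hs hK
  obtain ⟨b, hb0, hb1, hb⟩ := exists_tail_integral_lt_one hν hK
  have hstep : ∀ k : ℕ, (∃ B, B ≠ ∞ ∧ ∀ n, absMoment ν (s * b ^ k) n ≤ B) →
      ∃ B, B ≠ ∞ ∧ ∀ n, absMoment ν s n ≤ B := by
    intro k
    induction k with
    | zero => simp
    | succ k ih =>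
      intro h
      refine ih (absMoment_bounded_of_mul (by positivity)
        (mul_le_of_le_one_right hs.le (pow_le_one₀ hb0.le hb1.le)) hν hK hb ?_)
      rwa [mul_assoc, ← pow_succ]
  obtain ⟨k, hk⟩ := exists_pow_lt_of_lt_one (div_pos ht₀ hs) hb1
  have hkt : s * b ^ k ≤ t₀ := by
    rw [lt_div_iff₀ hs] at hk
    linarith
  have hks : s * b ^ k ≤ s := mul_le_of_le_one_right hs.le (pow_le_one₀ hb0.le hb1.le)
  refine hstep k (absMoment_bounded_of_lt_one hν (ne_top_of_le_ne_top hK ?_) (lt_of_le_of_lt ?_ hlt))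
  · exact lintegral_mono fun a => eexp_mono (by gcongr)
  · exact lintegral_mono fun a => mul_le_mul_left (eexp_mono (by gcongr)) _

lemma expMoment_perpetuity_lt_top [IsProbabilityMeasure ν] (hν : ∀ᵐ a ∂ν, |a.1| < 1) {s : ℝ} (hs : 0 < s)
    (hK : ∫⁻ a, eexp (s * |a.2|) ∂ν ≠ ∞) :
    expMoment (Measure.infinitePi fun _ : ℕ => ν) s (perpetuity fstSeq sndSeq) < ∞ := by
  obtain ⟨B, hB, hle⟩ := absMoment_bounded hν hs hK
  refine lt_of_le_of_lt ?_ hB.lt_top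
  calc expMoment (Measure.infinitePi fun _ : ℕ => ν) s (perpetuity fstSeq sndSeq)
      ≤ ∫⁻ x, ⨆ n, eexp (s * absPartialSum n x) ∂(Measure.infinitePi fun _ : ℕ => ν) := by
        refine lintegral_mono fun x => ?_
        -- A finite supremum bounds the absolute partial sums, by a ≤ e^a, so the series converges
        -- absolutely there.
        by_cases htop : (⨆ n, eexp (s * absPartialSum n x)) = ∞
        · simp only [htop, le_top]
        have hsum : Summable fun k => partialProd fstSeq k x * sndSeq k x := by
          refine Summable.of_abs (summable_of_sum_range_le
            (c := (⨆ n, eexp (s * absPartialSum n x)).toReal / s) (fun _ => abs_nonneg _) fun n => ?_)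
          rw [le_div_iff₀ hs, mul_comm]
          exact (ENNReal.ofReal_le_iff_le_toReal htop).1
            ((ofReal_le_eexp _).trans (le_iSup (fun n => eexp (s * absPartialSum n x)) n))
        have hz : Tendsto (fun n => partialSum fstSeq sndSeq n x) atTop (𝓝 _) :=
          hsum.hasSum.tendsto_sum_nat
        simp only [perpetuity_eq_of_tendsto hz, exp_mul_abs_coe]
        refine le_of_tendsto ((continuous_eexp.tendsto _).comp (hz.abs.const_mul s))
          (Eventually.of_forall fun n => ?_)
        refine le_trans (eexp_mono ?_) (le_iSup (fun n => eexp (s * absPartialSum n x)) n)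
        exact mul_le_mul_of_nonneg_left (abs_partialSum_le n x) hs.le
    _ = ⨆ n, absMoment ν s n := lintegral_iSup (fun n => measurable_eexp_absPartialSum s n)
        fun i j hij x => eexp_mono (mul_le_mul_of_nonneg_left (absPartialSum_mono x hij) hs.le)
    _ ≤ B := iSup_le hle

end Sufficiency

/-! ### Stationary laws of the random affine map and their self-couplings. -/

section Stationary

variable {ν : Measure (ℝ × ℝ)} {η : Measure ℝ}

/-- The random affine map `z ↦ q + m z`, jointly in the coefficients `(m, q)` and `z`. -/
def affineStep (p : (ℝ × ℝ) × ℝ) : ℝ := p.1.2 + p.1.1 * p.2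

lemma measurable_affineStep : Measurable affineStep := by
  unfold affineStep; fun_prop

/-- The action of one random affine map on both components of a pair. -/
def affineStepPair (p : (ℝ × ℝ) × (ℝ × ℝ)) : ℝ × ℝ :=
  (affineStep (p.1, p.2.1), affineStep (p.1, p.2.2))

lemma measurable_affineStepPair : Measurable affineStepPair := by
  unfold affineStepPair affineStep; fun_prop

variable (η) in
/-- The couplings of a measure with itself. -/
def selfCouplings : Set (Measure (ℝ × ℝ)) :=
  {ρ | IsProbabilityMeasure ρ ∧ ρ.map Prod.fst = η ∧ ρ.map Prod.snd = η}

lemma prod_mem_selfCouplings [IsProbabilityMeasure η] : η.prod η ∈ selfCouplings η :=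
  ⟨inferInstance, by simp [Measure.map_fst_prod], by simp [Measure.map_snd_prod]⟩

lemma map_affineStepPair_mem [IsProbabilityMeasure ν] (hst : (ν.prod η).map affineStep = η) {ρ : Measure (ℝ × ℝ)}
    (hρ : ρ ∈ selfCouplings η) : (ν.prod ρ).map affineStepPair ∈ selfCouplings η := by
  obtain ⟨hp, h1, h2⟩ := hρ
  refine ⟨Measure.isProbabilityMeasure_map measurable_affineStepPair.aemeasurable, ?_, ?_⟩
  · rw [Measure.map_map measurable_fst measurable_affineStepPair]
    conv_rhs => rw [← hst, ← h1]
    conv_rhs => rw [← Measure.map_id (μ := ν), Measure.map_prod_map _ _ measurable_id measurable_fst,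
      Measure.map_map measurable_affineStep (measurable_id.prodMap measurable_fst)]
    rfl
  · rw [Measure.map_map measurable_snd measurable_affineStepPair]
    conv_rhs => rw [← hst, ← h2]
    conv_rhs => rw [← Measure.map_id (μ := ν), Measure.map_prod_map _ _ measurable_id measurable_snd,
      Measure.map_map measurable_affineStep (measurable_id.prodMap measurable_snd)]
    rfl

/-- The `p`-th absolute moment of the difference of the components of a pair. -/
noncomputable def diffMoment (p : ℕ) (ρ : Measure (ℝ × ℝ)) : ℝ≥0∞ :=
  ∫⁻ z, ENNReal.ofReal |z.1 - z.2| ^ p ∂ρ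

/-- The common Q cancels in the difference, leaving the factor M, which is independent of the pair.
-/
lemma diffMoment_map_affineStepPair (p : ℕ) (ρ : Measure (ℝ × ℝ)) [SFinite ρ] :
    diffMoment p ((ν.prod ρ).map affineStepPair) =
      (∫⁻ a, ENNReal.ofReal |a.1| ^ p ∂ν) * diffMoment p ρ := by
  rw [diffMoment, lintegral_map (by fun_prop) measurable_affineStepPair, diffMoment,
    ← lintegral_prod_mul (by fun_prop) (by fun_prop)]
  refine lintegral_congr fun x => ?_
  simp only [affineStepPair, affineStep]
  rw [← mul_pow, ← ENNReal.ofReal_mul (abs_nonneg _), ← abs_mul]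
  congr 3
  ring

/-- Apply u^p / p! ≤ e^u to u = (s/2)|x - y|, which is at most s max(|x|, |y|). -/
lemma ofReal_abs_sub_pow_le {s : ℝ} (hs : 0 < s) (p : ℕ) (x y : ℝ) :
    ENNReal.ofReal |x - y| ^ p ≤
      ENNReal.ofReal (p.factorial * (2 / s) ^ p) * (eexp (s * |x|) + eexp (s * |y|)) := by
  rw [← ENNReal.ofReal_pow (abs_nonneg _), eexp, eexp,
    ← ENNReal.ofReal_add (Real.exp_pos _).le (Real.exp_pos _).le, ← ENNReal.ofReal_mul (by positivity)]
  refine ENNReal.ofReal_le_ofReal ?_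
  have h1 := Real.pow_div_factorial_le_exp (s / 2 * |x - y|) (by positivity) p
  rw [div_le_iff₀ (by positivity), mul_pow] at h1
  have h2 : Real.exp (s / 2 * |x - y|) ≤ Real.exp (s * |x|) + Real.exp (s * |y|) := by
    have hxy := abs_sub x y
    rcases le_total |x| |y| with h | h
    · have : Real.exp (s / 2 * |x - y|) ≤ Real.exp (s * |y|) := Real.exp_le_exp.2 (by nlinarith)
      linarith [Real.exp_pos (s * |x|)]
    · have : Real.exp (s / 2 * |x - y|) ≤ Real.exp (s * |x|) := Real.exp_le_exp.2 (by nlinarith)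
      linarith [Real.exp_pos (s * |y|)]
  calc |x - y| ^ p = (2 / s) ^ p * ((s / 2) ^ p * |x - y| ^ p) := by
        rw [← mul_assoc, ← mul_pow, div_mul_div_cancel₀ hs.ne', div_self two_ne_zero, one_pow, one_mul]
    _ ≤ (2 / s) ^ p * ((Real.exp (s * |x|) + Real.exp (s * |y|)) * p.factorial) := by
        exact mul_le_mul_of_nonneg_left (h1.trans (by gcongr)) (by positivity)
    _ = _ := by ring

/-- The bound involves only the marginals, hence is uniform over self-couplings. -/
lemma diffMoment_le {s : ℝ} (hs : 0 < s) (p : ℕ) {ρ : Measure (ℝ × ℝ)}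
    (hρ : ρ ∈ selfCouplings η) :
    diffMoment p ρ ≤ ENNReal.ofReal (p.factorial * (2 / s) ^ p) *
      (∫⁻ z, eexp (s * |z|) ∂η + ∫⁻ z, eexp (s * |z|) ∂η) := by
  have hm : Measurable fun z : ℝ => eexp (s * |z|) := by fun_prop
  calc diffMoment p ρ ≤ ∫⁻ z, ENNReal.ofReal (p.factorial * (2 / s) ^ p) *
        (eexp (s * |z.1|) + eexp (s * |z.2|)) ∂ρ :=
        lintegral_mono fun z => ofReal_abs_sub_pow_le hs p z.1 z.2
    _ = ENNReal.ofReal (p.factorial * (2 / s) ^ p) *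
        (∫⁻ z, eexp (s * |z.1|) ∂ρ + ∫⁻ z, eexp (s * |z.2|) ∂ρ) := by
        rw [lintegral_const_mul _ (by fun_prop), lintegral_add_left (by fun_prop)]
    _ = _ := by
        congr 2
        · conv_rhs => rw [← hρ.2.1, lintegral_map hm measurable_fst]
        · conv_rhs => rw [← hρ.2.2, lintegral_map hm measurable_snd]

/-- Otherwise η × η sits on the diagonal, so η is a point mass at some c, and stationarity makes c
an a.s. fixed point. -/
lemma diffMoment_prod_ne_zero [IsProbabilityMeasure η] (hst : (ν.prod η).map affineStep = η)
    (hdegen : ∀ c : ℝ, ¬ ∀ᵐ a ∂ν, a.2 + a.1 * c = c) {p : ℕ} (hp : p ≠ 0) :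
    diffMoment p (η.prod η) ≠ 0 := by
  intro h0
  rw [diffMoment, lintegral_eq_zero_iff (by fun_prop)] at h0
  have h1 : ∀ᵐ z ∂η.prod η, z.1 = z.2 := by
    filter_upwards [h0] with z hz
    have : |z.1 - z.2| ≤ 0 := by simpa [hp] using hz
    exact sub_eq_zero.1 (abs_eq_zero.1 (this.antisymm (abs_nonneg _)))
  obtain ⟨c, hc⟩ := (Measure.ae_ae_of_ae_prod h1).exists
  refine hdegen c ?_
  have h2 : ∀ᵐ z ∂η, z = c := hc.mono fun z hz => hz.symm
  have h3 : ∀ᵐ q ∂ν.prod η, affineStep q = c := by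
    rw [← hst] at h2
    exact ae_of_ae_map measurable_affineStep.aemeasurable h2
  filter_upwards [Measure.ae_ae_of_ae_prod h3] with a ha
  obtain ⟨z, hz, rfl⟩ := (ha.and h2).exists
  exact hz

lemma lintegral_pow_le_one [IsProbabilityMeasure ν] [IsProbabilityMeasure η]
    (hst : (ν.prod η).map affineStep = η)
    (hdegen : ∀ c : ℝ, ¬ ∀ᵐ a ∂ν, a.2 + a.1 * c = c) {s : ℝ} (hs : 0 < s)
    (hexp : ∫⁻ z, eexp (s * |z|) ∂η ≠ ∞) {p : ℕ} (hp : p ≠ 0) :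
    ∫⁻ a, ENNReal.ofReal |a.1| ^ p ∂ν ≤ 1 := by
  set S : ℝ≥0∞ := ⨆ ρ : selfCouplings η, diffMoment p ρ with hS
  have hS0 : S ≠ 0 := fun h => diffMoment_prod_ne_zero hst hdegen hp
    (le_antisymm (h ▸ le_iSup (fun ρ : selfCouplings η => diffMoment p ρ)
      ⟨_, prod_mem_selfCouplings⟩) zero_le)
  have hSt : S ≠ ∞ := ne_top_of_le_ne_top
    (ENNReal.mul_ne_top ENNReal.ofReal_ne_top (ENNReal.add_ne_top.2 ⟨hexp, hexp⟩))
    (iSup_le fun ρ => diffMoment_le hs p ρ.2)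
  have hle : (∫⁻ a, ENNReal.ofReal |a.1| ^ p ∂ν) * S ≤ 1 * S := by
    rw [one_mul]
    conv_lhs => rw [hS, ENNReal.mul_iSup]
    refine iSup_le fun ρ => ?_
    have := ρ.2.1
    rw [← diffMoment_map_affineStepPair]
    exact le_iSup (fun ρ : selfCouplings η => diffMoment p ρ) ⟨_, map_affineStepPair_mem hst ρ.2⟩
  exact (ENNReal.mul_le_mul_iff_left hS0 hSt).1 hle

/-- By Fatou the liminf of the powers is a.s. finite, whereas it is infinite where |M| > 1. -/
lemma ae_abs_le_one_of_lintegral_pow_le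
    (h : ∀ p : ℕ, p ≠ 0 → ∫⁻ a, ENNReal.ofReal |a.1| ^ p ∂ν ≤ 1) : ∀ᵐ a ∂ν, |a.1| ≤ 1 := by
  have hm : ∀ p : ℕ, Measurable fun a : ℝ × ℝ => ENNReal.ofReal |a.1| ^ (p + 1) := fun p => by
    fun_prop
  have hF : ∫⁻ a, liminf (fun p : ℕ => ENNReal.ofReal |a.1| ^ (p + 1)) atTop ∂ν ≤ 1 := by
    refine (lintegral_liminf_le hm).trans ?_
    refine (liminf_le_liminf (Eventually.of_forall fun p => h (p + 1) p.succ_ne_zero)).trans ?_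
    simp
  filter_upwards [ae_lt_top (.liminf hm) (ne_top_of_le_ne_top ENNReal.one_ne_top hF)] with a ha
  by_contra! hlt
  refine ha.ne (Tendsto.liminf_eq ?_)
  refine (tendsto_add_atTop_iff_nat (f := fun p => ENNReal.ofReal |a.1| ^ p) 1).2 ?_
  exact ENNReal.tendsto_pow_atTop_nhds_top_iff.2 (by simpa using hlt)

/-- For |M| < 1, |Q| - |Z'| ≤ |Q + MZ'|; independence then gives E e^{s|Q|} · E e^{-s|Z'|} ≤ E
e^{s|Z|}, with a positive second factor. -/
lemma lintegral_eexp_ne_top_of_stationary [SFinite ν] [IsProbabilityMeasure η]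
    (hst : (ν.prod η).map affineStep = η)
    (hν : ∀ᵐ a ∂ν, |a.1| < 1) {s : ℝ} (hs : 0 < s) (hexp : ∫⁻ z, eexp (s * |z|) ∂η ≠ ∞) :
    ∫⁻ a, eexp (s * |a.2|) ∂ν ≠ ∞ := by
  have hpos : ∫⁻ z, eexp (-(s * |z|)) ∂η ≠ 0 := by
    rw [Ne, lintegral_eq_zero_iff (by fun_prop)]
    intro h0
    obtain ⟨z, hz⟩ := h0.exists
    exact (eexp_pos _).ne' hz
  intro htop
  refine hexp (top_unique ?_)
  calc ∞ = (∫⁻ a, eexp (s * |a.2|) ∂ν) * ∫⁻ z, eexp (-(s * |z|)) ∂η := by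
        rw [htop, ENNReal.top_mul hpos]
    _ = ∫⁻ p, eexp (s * |p.1.2|) * eexp (-(s * |p.2|)) ∂(ν.prod η) :=
        (lintegral_prod_mul (f := fun a : ℝ × ℝ => eexp (s * |a.2|))
          (g := fun z : ℝ => eexp (-(s * |z|))) (by fun_prop) (by fun_prop)).symm
    _ ≤ ∫⁻ p, eexp (s * |affineStep p|) ∂(ν.prod η) := by
        refine lintegral_mono_ae ?_
        have hν' : ∀ᵐ p ∂ν.prod η, |p.1.1| < 1 :=
          Measure.quasiMeasurePreserving_fst.ae hν
        filter_upwards [hν'] with p hp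
        rw [← eexp_add]
        refine eexp_mono ?_
        have h1 : |p.1.2| ≤ |affineStep p| + |p.1.1| * |p.2| := by
          have := abs_sub (affineStep p) (p.1.1 * p.2)
          rwa [affineStep, add_sub_cancel_right, abs_mul] at this
        have h2 : |p.1.1| * |p.2| ≤ |p.2| := mul_le_of_le_one_left (abs_nonneg _) hp.le
        nlinarith
    _ = ∫⁻ z, eexp (s * |z|) ∂η := by
        conv_rhs => rw [← hst]
        rw [lintegral_map (by fun_prop) measurable_affineStep]

end Stationary

/-! ### Necessity: the perpetuity has a stationary law. -/

section Necessity

variable {ν : Measure (ℝ × ℝ)} [IsProbabilityMeasure ν]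

/-- The perpetuity with a finite exponential moment converges almost surely. -/
lemma ae_summable_of_expMoment_lt_top {Ω : Type*} [MeasurableSpace Ω] {μ : Measure Ω}
    {M Q : ℕ → Ω → ℝ} (hM : ∀ n, Measurable (M n)) (hQ : ∀ n, Measurable (Q n)) {s : ℝ}
    (hs : 0 < s) (h : expMoment μ s (perpetuity M Q) < ∞) :
    ∀ᵐ ω ∂μ, ∃ z : ℝ, Tendsto (fun n => partialSum M Q n ω) atTop (𝓝 z) := by
  set A := {ω | ∃ z : ℝ, Tendsto (fun n => partialSum M Q n ω) atTop (𝓝 z)} with hA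
  have hAm : MeasurableSet A := measurableSet_summable hM hQ
  have hle : ∞ * μ Aᶜ ≤ expMoment μ s (perpetuity M Q) := by
    rw [← lintegral_indicator_const hAm.compl]
    refine lintegral_mono fun ω => ?_
    by_cases hω : ω ∈ A
    · simp [hω]
    · simp [perpetuity_eq_top hω, EReal.coe_mul_top_of_pos hs]
  by_contra hne
  exact absurd (hle.trans_lt h) (by rw [ENNReal.top_mul hne]; simp)

/-- Passing to the limit in the first-step recursion gives the fixed-point equation off a null set,
so the default value of `limitSum` is harmless. -/
lemma map_limitSum_stationary
    (hconv : ∀ᵐ x ∂(Measure.infinitePi fun _ : ℕ => ν),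
      ∃ z : ℝ, Tendsto (fun n => partialSum fstSeq sndSeq n x) atTop (𝓝 z)) :
    (ν.prod ((Measure.infinitePi fun _ : ℕ => ν).map (limitSum fstSeq sndSeq))).map affineStep =
      (Measure.infinitePi fun _ : ℕ => ν).map (limitSum fstSeq sndSeq) := by
  have hm : Measurable (limitSum fstSeq sndSeq) :=
    measurable_limitSum measurable_fstSeq measurable_sndSeq
  conv_rhs => rw [← map_consSeq ν, Measure.map_map hm measurable_consSeq]
  have hprod := Measure.map_prod_map ν (Measure.infinitePi fun _ : ℕ => ν) measurable_id hm
  rw [Measure.map_id] at hprod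
  rw [hprod, Measure.map_map measurable_affineStep (measurable_id.prodMap hm)]
  refine Measure.map_congr ?_
  have hconv' : ∀ᵐ p ∂ν.prod (Measure.infinitePi fun _ : ℕ => ν),
      ∃ z : ℝ, Tendsto (fun n => partialSum fstSeq sndSeq n p.2) atTop (𝓝 z) :=
    Measure.quasiMeasurePreserving_snd.ae hconv
  filter_upwards [hconv'] with p hp
  have h1 := ((tendsto_nhds_limUnder hp).const_mul p.1.1).const_add p.1.2
  have h2 : Tendsto (fun n => partialSum fstSeq sndSeq n (consSeq p)) atTop
      (𝓝 (p.1.2 + p.1.1 * limitSum fstSeq sndSeq p.2)) :=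
    (tendsto_add_atTop_iff_nat 1).1 (h1.congr fun n => (partialSum_consSeq p.1 p.2 n).symm)
  exact h2.limUnder_eq.symm

lemma necessary_of_expMoment_perpetuity_lt_top
    (hdegen : ∀ c : ℝ, ¬ ∀ᵐ a ∂ν, a.2 + a.1 * c = c) (hone : ∀ᵐ a ∂ν, |a.1| ≠ 1)
    {s : ℝ} (hs : 0 < s)
    (h : expMoment (Measure.infinitePi fun _ : ℕ => ν) s (perpetuity fstSeq sndSeq) < ∞) :
    (∀ᵐ a ∂ν, |a.1| < 1) ∧ ∫⁻ a, eexp (s * |a.2|) ∂ν ≠ ∞ := by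
  have hm : Measurable (limitSum fstSeq sndSeq) :=
    measurable_limitSum measurable_fstSeq measurable_sndSeq
  have hconv := ae_summable_of_expMoment_lt_top measurable_fstSeq measurable_sndSeq hs h
  have hst := map_limitSum_stationary hconv
  have hexp : ∫⁻ z, eexp (s * |z|)
      ∂((Measure.infinitePi fun _ : ℕ => ν).map (limitSum fstSeq sndSeq)) ≠ ∞ := by
    rw [lintegral_map (by fun_prop) hm]
    refine ne_of_lt (lt_of_le_of_lt (lintegral_mono_ae ?_) h)
    filter_upwards [hconv] with x hx
    rw [perpetuity_eq_of_tendsto (tendsto_nhds_limUnder hx), exp_mul_abs_coe]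
    rfl
  have := Measure.isProbabilityMeasure_map (μ := Measure.infinitePi fun _ : ℕ => ν) hm.aemeasurable
  have hlt : ∀ᵐ a ∂ν, |a.1| < 1 := by
    filter_upwards [hone, ae_abs_le_one_of_lintegral_pow_le fun p hp =>
      lintegral_pow_le_one hst hdegen hs hexp hp] with a h1 h2
    exact lt_of_le_of_ne h2 h1
  exact ⟨hlt, lintegral_eexp_ne_top_of_stationary hst hlt hs hexp⟩

/-- The characterization of finite exponential moments for the sequence of coordinates. -/
lemma expMoment_perpetuity_lt_top_iff
    (hdegen : ∀ c : ℝ, ¬ ∀ᵐ a ∂ν, a.2 + a.1 * c = c) (hone : ∀ᵐ a ∂ν, |a.1| ≠ 1)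
    {s : ℝ} (hs : 0 < s) :
    expMoment (Measure.infinitePi fun _ : ℕ => ν) s (perpetuity fstSeq sndSeq) < ∞ ↔
      (∀ᵐ a ∂ν, |a.1| < 1) ∧ ∫⁻ a, eexp (s * |a.2|) ∂ν ≠ ∞ :=
  ⟨necessary_of_expMoment_perpetuity_lt_top hdegen hone hs,
    fun h => expMoment_perpetuity_lt_top h.1 hs h.2⟩

end Necessity

/-! ### Transfer to an arbitrary probability space. -/

lemma measurable_ereal_abs : Measurable EReal.abs := by
  refine EReal.measurable_of_measurable_real ?_
  simp only [EReal.abs_def]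
  fun_prop

lemma expMoment_comp {Ω Ω' : Type*} [MeasurableSpace Ω] [MeasurableSpace Ω'] {μ : Measure Ω}
    {X : Ω → Ω'} (hX : Measurable X) (s : ℝ) {Z : Ω' → EReal} (hZ : Measurable Z) :
    expMoment μ s (Z ∘ X) = expMoment (μ.map X) s Z := by
  unfold expMoment
  rw [lintegral_map ?_ hX]
  · rfl
  · exact EReal.measurable_exp.comp
      (((measurable_ereal_abs.comp hZ).coe_ereal_ennreal).const_mul _)

end Perpetuity

theorem theorem3 {Ω : Type*} [MeasurableSpace Ω] (μ : Measure Ω) [IsProbabilityMeasure μ]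
    (Mseq Qseq : ℕ → Ω → ℝ) (M Q : Ω → ℝ)
    (hMmeas : ∀ n, Measurable (Mseq n)) (hQmeas : ∀ n, Measurable (Qseq n))
    (hindep : iIndepFun (fun n ω => (Mseq n ω, Qseq n ω)) μ)
    (hident : ∀ n, IdentDistrib (fun ω => (Mseq n ω, Qseq n ω)) (fun ω => (M ω, Q ω)) μ μ)
    (hM0 : μ {ω | M ω = 0} = 0) (hQ0 : μ {ω | Q ω = 0} < 1)
    (hdegen : ∀ c : ℝ, μ {ω | Q ω + M ω * c = c} < 1)
    (hM1 : μ {ω | |M ω| = 1} = 0) :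
    (∀ s : ℝ, 0 < s →
      (Perpetuity.expMoment μ s (Perpetuity.perpetuity Mseq Qseq) < ∞ ↔
        μ {ω | |M ω| < 1} = 1 ∧ Perpetuity.expMoment μ s (fun ω => (Q ω : EReal)) < ∞)) ∧
    (μ {ω | |M ω| < 1} = 1 →
      Perpetuity.abscissa μ (Perpetuity.perpetuity Mseq Qseq) =
        Perpetuity.abscissa μ (fun ω => (Q ω : EReal))) := by
  have hMQ : AEMeasurable (fun ω => (M ω, Q ω)) μ := (hident 0).aemeasurable_snd
  set ν : Measure (ℝ × ℝ) := μ.map fun ω => (M ω, Q ω) with hν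
  have hprob : IsProbabilityMeasure ν := Measure.isProbabilityMeasure_map hMQ
  set X : Ω → ℕ → ℝ × ℝ := fun ω n => (Mseq n ω, Qseq n ω) with hX
  have hpair : ∀ n, Measurable fun ω => (Mseq n ω, Qseq n ω) := fun n =>
    (hMmeas n).prodMk (hQmeas n)
  have hXm : Measurable X := measurable_pi_iff.2 hpair
  have hlaw : μ.map X = Measure.infinitePi fun _ : ℕ => ν := by
    rw [hX, (iIndepFun_iff_map_fun_eq_infinitePi_map hpair).1 hindep]
    congr 1
    funext n
    exact (hident n).map_eq
  have hperp : ∀ s, Perpetuity.expMoment μ s (Perpetuity.perpetuity Mseq Qseq) =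
      Perpetuity.expMoment (Measure.infinitePi fun _ : ℕ => ν) s
        (Perpetuity.perpetuity Perpetuity.fstSeq Perpetuity.sndSeq) := fun s => by
    rw [← hlaw, ← Perpetuity.expMoment_comp hXm s (Perpetuity.measurable_perpetuity
      Perpetuity.measurable_fstSeq Perpetuity.measurable_sndSeq)]
    rfl
  have hQexp : ∀ s, Perpetuity.expMoment μ s (fun ω => (Q ω : EReal)) =
      ∫⁻ a, Perpetuity.eexp (s * |a.2|) ∂ν := fun s => by
    rw [hν, lintegral_map' (by fun_prop) hMQ]
    exact lintegral_congr fun ω => Perpetuity.exp_mul_abs_coe s (Q ω)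
  have hlt : μ {ω | |M ω| < 1} = 1 ↔ ∀ᵐ a ∂ν, |a.1| < 1 := by
    have hms : MeasurableSet {a : ℝ × ℝ | |a.1| < 1} :=
      measurableSet_lt (by fun_prop) measurable_const
    rw [hν, ae_map_iff hMQ hms]
    -- The generic copy (M, Q) is only a.e. measurable, so its events are only null measurable.
    exact (mem_ae_iff_prob_eq_one₀ (hMQ.nullMeasurableSet_preimage hms)).symm
  have hone : ∀ᵐ a ∂ν, |a.1| ≠ 1 := by
    have hms : MeasurableSet {a : ℝ × ℝ | |a.1| ≠ 1} :=
      (measurableSet_eq_fun (by fun_prop) measurable_const).compl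
    rw [hν, ae_map_iff hMQ hms, ae_iff]
    simpa using hM1
  have hdeg : ∀ c : ℝ, ¬ ∀ᵐ a ∂ν, a.2 + a.1 * c = c := fun c hc => by
    refine (hdegen c).ne ?_
    have hms : MeasurableSet {a : ℝ × ℝ | a.2 + a.1 * c = c} :=
      measurableSet_eq_fun (by fun_prop) measurable_const
    exact (mem_ae_iff_prob_eq_one₀ (hMQ.nullMeasurableSet_preimage hms)).1 (ae_of_ae_map hMQ hc)
  have hiff : ∀ s : ℝ, 0 < s →
      (Perpetuity.expMoment μ s (Perpetuity.perpetuity Mseq Qseq) < ∞ ↔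
        μ {ω | |M ω| < 1} = 1 ∧ Perpetuity.expMoment μ s (fun ω => (Q ω : EReal)) < ∞) :=
    fun s hs => by
      rw [hperp, hQexp, hlt, lt_top_iff_ne_top (a := ∫⁻ a, Perpetuity.eexp (s * |a.2|) ∂ν)]
      exact Perpetuity.expMoment_perpetuity_lt_top_iff hdeg hone hs
  refine ⟨hiff, fun hM => ?_⟩
  unfold Perpetuity.abscissa
  congr 1
  ext a
  refine exists_congr fun r => and_congr_right fun hr => and_congr_left fun _ => ?_
  rw [hiff r hr, and_iff_right hM]
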